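/- An overpartition of a nonnegative integer $m$ is a partition of $m$ in which the first occurrence of each part size may be overlined (the empty partition is the only overpartition of $0$). An overpartition triple of $N$ is an ordered triple $(\omega_1,\omega_2,\omega_3)$ of (possibly empty) overpartitions such that the sum of all their parts is $N$; let $\overline{p}_3(N)$ denote the number of overpartition triples of $N$. Let $r_3(n)$ denote the number of representations of $n$ as a sum of three squares, that is, the number of triples $(x_1,x_2,x_3)\in\mathbb{Z}^3$ with $x_1^2+x_2^2+x_3^2=n$. Then for every integer $n\ge 1$, \[ \overline{p}_3(7n)\equiv (-1)^n\, r_3(n) \pmod 7 . \] -/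

import Mathlib

/-- An overpartition of `n`: a partition of `n` in which, for each part size that occurs, the first
occurrence may be overlined. It is recorded as the partition and the set of overlined part sizes. -/
structure Overpartition (n : ℕ) where
  toPartition : n.Partition
  overlined : Finset ℕ
  overlined_subset : overlined ⊆ toPartition.parts.toFinset

/-- An overpartition `k`-tuple of `n`: a `k`-tuple of overpartitions (some possibly empty) such that
the sum of all the parts is `n`. -/
structure OverpartitionTuple (k n : ℕ) where
  size : Fin k → ℕ
  component : (i : Fin k) → Overpartition (size i)
  sum_size : ∑ i, size i = n

instance Overpartition.instFinite (n : ℕ) : Finite (Overpartition n) := by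
  refine Finite.of_injective
    (β := Σ p : n.Partition, {s : Finset ℕ // s ∈ p.parts.toFinset.powerset})
    (fun w => ⟨w.toPartition, w.overlined, Finset.mem_powerset.2 w.overlined_subset⟩) ?_
  rintro ⟨p, s, hs⟩ ⟨p', s', hs'⟩ h
  obtain ⟨h1, h2⟩ := Sigma.mk.inj_iff.1 h
  dsimp only at h1 h2
  subst h1
  have h3 := congrArg Subtype.val (eq_of_heq h2)
  dsimp only at h3
  subst h3
  rfl

instance OverpartitionTuple.instFinite (k n : ℕ) : Finite (OverpartitionTuple k n) := by
  have hfin : Finite {a : Fin k → ℕ // ∑ i, a i = n} :=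
    ((Finset.piAntidiag Finset.univ n).finite_toSet.subset
      (fun a (ha : ∑ i, a i = n) => by simp [ha])).to_subtype
  have hpi : ∀ a : {a : Fin k → ℕ // ∑ i, a i = n},
      Finite ((i : Fin k) → Overpartition (a.1 i)) := fun a => Pi.finite
  refine Finite.of_injective
    (β := Σ a : {a : Fin k → ℕ // ∑ i, a i = n}, ((i : Fin k) → Overpartition (a.1 i)))
    (fun w => ⟨⟨w.size, w.sum_size⟩, w.component⟩) ?_
  rintro ⟨a, c, ha⟩ ⟨a', c', ha'⟩ h
  obtain ⟨h1, h2⟩ := Sigma.mk.inj_iff.1 h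
  have h3 := congrArg Subtype.val h1
  dsimp only at h2 h3
  subst h3
  have h4 := eq_of_heq h2
  subst h4
  rfl

/-- The number of overpartition `k`-tuples of `n`. -/
noncomputable def overpartitionTupleCount (k n : ℕ) : ℕ :=
  Nat.card (OverpartitionTuple k n)

instance finite_sumOfSquaresReps (k n : ℕ) :
    Finite {x : Fin k → ℤ // ∑ i, x i ^ 2 = (n : ℤ)} := by
  refine Set.Finite.to_subtype (s := {x : Fin k → ℤ | ∑ i, x i ^ 2 = (n : ℤ)}) ?_
  refine (Set.finite_Icc (fun _ : Fin k => -(n : ℤ)) (fun _ => (n : ℤ))).subset ?_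
  intro x hx
  have hx' : ∑ i, x i ^ 2 = (n : ℤ) := hx
  have h : ∀ i, x i ^ 2 ≤ (n : ℤ) := fun i => by
    rw [← hx']
    exact Finset.single_le_sum (f := fun i => x i ^ 2) (fun j _ => sq_nonneg (x j))
      (Finset.mem_univ i)
  have habs : ∀ i, |x i| ≤ (n : ℤ) := fun i => by
    refine le_trans ?_ (h i)
    rw [← sq_abs]
    exact Int.le_self_sq _
  exact ⟨fun i => (abs_le.1 (habs i)).1, fun i => (abs_le.1 (habs i)).2⟩

/-- The number of representations of `n` as a sum of `k` squares of integers, where order and signs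
are taken into account. -/
noncomputable def sumOfSquaresRepCount (k n : ℕ) : ℕ :=
  Nat.card {x : Fin k → ℤ // ∑ i, x i ^ 2 = (n : ℤ)}

/-! Let `P` be the overpartition series and `Θ = ∑ (-1)^x q^(x^2)`. Gauss's identity gives `P * Θ =
1` (`overpartitionSeries_mul_altThetaSeries`). Modulo 7, Frobenius gives `Θ(q^7) = Θ^7`, so `P^3 *
Θ(q^7) = Θ^4`. Keeping the coefficients of index `7n`, with `U` for this extraction, gives `U(P^3) *
Θ = U(Θ^4)`. Since `r_4(7n) ≡ r_4(n)` modulo 7 (`sumOfSquaresRepCount_four_mul_seven`, by counting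
quaternion divisors of norm 7), `U(Θ^4) = Θ^4`. Cancelling `Θ` leaves `U(P^3) = Θ^3`, whose
coefficients are `(-1)^n r_3(n)`. -/

/-- Finite form of Gauss's identity for `∑ (-1)^k q^(k^2)`. -/
theorem finite_gauss_identity {R : Type*} [CommRing R] (q : R) (n : ℕ) :
    (∏ k ∈ Finset.range n, (1 + q ^ (k + 1))) *
        (1 + 2 * ∑ k ∈ Finset.range n, (-1) ^ (k + 1) * q ^ ((k + 1) ^ 2)) =
      ∏ k ∈ Finset.range n, (1 - q ^ (k + 1)) +
        ∑ t ∈ Finset.range n, 2 * (-1) ^ (t + 1) * (∏ k ∈ Finset.Ico (t + 1) n, (1 - q ^ (k + 1))) *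
          (∏ k ∈ Finset.range t, (1 + q ^ (k + 1))) * q ^ ((t + 1) * (n + 1)) := by
  induction n with
  | zero => simp
  | succ n ih =>
    set b : ℕ → R := fun t => ∏ k ∈ Finset.range t, (1 + q ^ (k + 1)) with hb
    have hbs : ∀ t, b (t + 1) = b t * (1 + q ^ (t + 1)) := fun t => Finset.prod_range_succ _ _
    set a : ℕ → ℕ → R := fun t n => ∏ k ∈ Finset.Ico t n, (1 - q ^ (k + 1)) with ha
    have ha0 : ∀ n, ∏ k ∈ Finset.range n, (1 - q ^ (k + 1)) = a 0 n := fun n => by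
      rw [ha, Finset.range_eq_Ico]
    have hat : ∀ t n, t ≤ n → a t (n + 1) = a t n * (1 - q ^ (n + 1)) := fun t n h =>
      Finset.prod_Ico_succ_top h _
    have hab : ∀ t n, t < n → a t n = (1 - q ^ (t + 1)) * a (t + 1) n := fun t n h =>
      Finset.prod_eq_prod_Ico_succ_bot h _
    change b n * _ = _ + ∑ t ∈ Finset.range n, 2 * (-1) ^ (t + 1) * a (t + 1) n * b t *
      q ^ ((t + 1) * (n + 1)) at ih
    change b (n + 1) * _ = _ + ∑ t ∈ Finset.range (n + 1), 2 * (-1) ^ (t + 1) *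
      a (t + 1) (n + 1) * b t * q ^ ((t + 1) * (n + 1 + 1))
    rw [ha0] at ih ⊢
    have hself : ∀ n, a n n = 1 := fun n => by simp [ha]
    -- Raising `n` multiplies each remainder term by `1 + q ^ (n + 1)`, up to the telescoping error
    -- `G t - G (t + 1)`.
    set G : ℕ → R := fun t => 2 * (-1) ^ t * q ^ ((t + 1) * (n + 1)) * a t n * b t with hG
    have htel : ∑ t ∈ Finset.range n, 2 * (-1) ^ (t + 1) * a (t + 1) (n + 1) * b t *
        q ^ ((t + 1) * (n + 1 + 1)) = (1 + q ^ (n + 1)) *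
        ∑ t ∈ Finset.range n, 2 * (-1) ^ (t + 1) * a (t + 1) n * b t * q ^ ((t + 1) * (n + 1)) +
        (G 0 - G n) := by
      rw [← Finset.sum_range_sub', Finset.mul_sum, ← Finset.sum_add_distrib]
      refine Finset.sum_congr rfl fun t ht => ?_
      have ht := Finset.mem_range.1 ht
      simp only [hG]
      rw [hat _ _ ht, hab t n ht, hbs]
      ring
    rw [Finset.sum_range_succ (fun t => 2 * (-1) ^ (t + 1) * a (t + 1) (n + 1) * b t *
      q ^ ((t + 1) * (n + 1 + 1))), htel, Finset.sum_range_succ, hself, hat 0 n (Nat.zero_le _), hbs]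
    have hG0 : G 0 = 2 * q ^ (n + 1) * a 0 n := by simp [hG, hb]
    have hGn : G n = 2 * (-1) ^ n * q ^ ((n + 1) * (n + 1)) * b n := by simp [hG, hself]
    rw [hG0, hGn]
    linear_combination (1 + q ^ (n + 1)) * ih

/-! ### Four squares and integral quaternions of norm 7 -/

/-- `1` or `-1`, according to a Boolean. -/
def boolSign (R : Type*) [One R] [Neg R] (b : Bool) : R :=
  if b then 1 else -1

/-- Quaternions over `ZMod 7` form a 2 × 2 matrix algebra. A nonzero singular element has one of 8
lines as image, and the 8 sign choices realise these lines, so the count is 1; for zero it is 8. The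
four equations are the coordinates of `star s * x`. -/
theorem card_filter_left_divisor_mod_seven : ∀ x y z w : ZMod 7,
    x * x + y * y + z * z + w * w = 0 →
    (Finset.univ.filter fun s : Bool × Bool × Bool =>
      2 * x + boolSign (ZMod 7) s.1 * y + boolSign (ZMod 7) s.2.1 * z +
          boolSign (ZMod 7) s.2.2 * w = 0 ∧
      2 * y - boolSign (ZMod 7) s.1 * x - boolSign (ZMod 7) s.2.1 * w +
          boolSign (ZMod 7) s.2.2 * z = 0 ∧
      2 * z + boolSign (ZMod 7) s.1 * w - boolSign (ZMod 7) s.2.1 * x -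
          boolSign (ZMod 7) s.2.2 * y = 0 ∧
      2 * w - boolSign (ZMod 7) s.1 * z + boolSign (ZMod 7) s.2.1 * y -
          boolSign (ZMod 7) s.2.2 * x = 0).card % 7 = 1 := by
  decide +kernel

open Quaternion

/-- The quaternions `2 ± i ± j ± k`, which represent the classes of norm `7`. -/
def normSevenQuaternion (s : Bool × Bool × Bool) : ℍ[ℤ] :=
  ⟨2, boolSign ℤ s.1, boolSign ℤ s.2.1, boolSign ℤ s.2.2⟩

@[simp]
theorem re_normSevenQuaternion (s : Bool × Bool × Bool) : (normSevenQuaternion s).re = 2 := rfl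

@[simp]
theorem imI_normSevenQuaternion (s : Bool × Bool × Bool) :
    (normSevenQuaternion s).imI = boolSign ℤ s.1 := rfl

@[simp]
theorem imJ_normSevenQuaternion (s : Bool × Bool × Bool) :
    (normSevenQuaternion s).imJ = boolSign ℤ s.2.1 := rfl

@[simp]
theorem imK_normSevenQuaternion (s : Bool × Bool × Bool) :
    (normSevenQuaternion s).imK = boolSign ℤ s.2.2 := rfl

theorem normSq_normSevenQuaternion (s : Bool × Bool × Bool) :
    normSq (normSevenQuaternion s) = 7 := by
  obtain ⟨a, b, c⟩ := s
  rw [normSq_def']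
  cases a <;> cases b <;> cases c <;> simp [boolSign]

theorem cast_boolSign (b : Bool) : ((boolSign ℤ b : ℤ) : ZMod 7) = boolSign (ZMod 7) b := by
  cases b <;> simp [boolSign]

theorem Quaternion.seven_dvd_iff (x : ℍ[ℤ]) :
    7 ∣ x ↔ (x.re : ZMod 7) = 0 ∧ (x.imI : ZMod 7) = 0 ∧ (x.imJ : ZMod 7) = 0 ∧
      (x.imK : ZMod 7) = 0 := by
  have h : ∀ a : ℤ, (a : ZMod 7) = 0 ↔ (7 : ℤ) ∣ a := fun a =>
    ZMod.intCast_zmod_eq_zero_iff_dvd a 7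
  simp only [h]
  have hre : (7 : ℍ[ℤ]).re = 7 := rfl
  have hI : (7 : ℍ[ℤ]).imI = 0 := rfl
  have hJ : (7 : ℍ[ℤ]).imJ = 0 := rfl
  have hK : (7 : ℍ[ℤ]).imK = 0 := rfl
  constructor
  · rintro ⟨y, rfl⟩
    simp [hre, hI, hJ, hK]
  · rintro ⟨⟨a, ha⟩, ⟨b, hb⟩, ⟨c, hc⟩, ⟨d, hd⟩⟩
    refine ⟨⟨a, b, c, d⟩, ?_⟩
    have hy : ∀ y : ℍ[ℤ], (7 * y).re = 7 * y.re ∧ (7 * y).imI = 7 * y.imI ∧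
        (7 * y).imJ = 7 * y.imJ ∧ (7 * y).imK = 7 * y.imK := fun y => by
      simp [hre, hI, hJ, hK]
    exact QuaternionAlgebra.ext (ha.trans (hy ⟨a, b, c, d⟩).1.symm) (hb.trans (hy ⟨a, b, c, d⟩).2.1.symm)
      (hc.trans (hy ⟨a, b, c, d⟩).2.2.1.symm) (hd.trans (hy ⟨a, b, c, d⟩).2.2.2.symm)

open scoped Classical in
theorem card_filter_dvd_star_mul_mod_seven (x : ℍ[ℤ]) (hx : 7 ∣ normSq x) :
    (Finset.univ.filter fun s => 7 ∣ star (normSevenQuaternion s) * x).card % 7 = 1 := by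
  have h := card_filter_left_divisor_mod_seven x.re x.imI x.imJ x.imK (by
    have := (ZMod.intCast_zmod_eq_zero_iff_dvd (normSq x) 7).2 hx
    rw [normSq_def'] at this
    push_cast at this
    linear_combination this)
  rw [← h]
  congr 2
  ext s
  simp only [Finset.mem_filter, Finset.mem_univ, true_and, Quaternion.seven_dvd_iff]
  simp [cast_boolSign, sub_eq_add_neg, add_comm, add_left_comm]

/-- Integral quaternions of a given norm. -/
abbrev QuaternionOfNorm (n : ℕ) := {x : ℍ[ℤ] // normSq x = (n : ℤ)}

/-- Integral quaternions of norm `n` are the representations of `n` as a sum of four squares. -/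
def quaternionOfNormEquiv (n : ℕ) :
    QuaternionOfNorm n ≃ {x : Fin 4 → ℤ // ∑ i, x i ^ 2 = (n : ℤ)} :=
  (Quaternion.equivTuple ℤ).subtypeEquiv fun x => by
    simp [Fin.sum_univ_four, normSq_def']

instance (n : ℕ) : Finite (QuaternionOfNorm n) :=
  Finite.of_equiv _ (quaternionOfNormEquiv n).symm

/-- Left multiplication by a quaternion of norm `7`. -/
noncomputable def mulNormSevenEquiv (n : ℕ) (s : Bool × Bool × Bool) :
    QuaternionOfNorm n ≃
      {x : QuaternionOfNorm (7 * n) // 7 ∣ star (normSevenQuaternion s) * x.1} := by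
  have h7 : star (normSevenQuaternion s) * normSevenQuaternion s = 7 := by
    rw [star_mul_self, normSq_normSevenQuaternion]; rfl
  have h7' : normSevenQuaternion s * star (normSevenQuaternion s) = 7 := by
    rw [self_mul_star, normSq_normSevenQuaternion]; rfl
  have h70 : (7 : ℍ[ℤ]) ≠ 0 := by
    rw [← h7, star_mul_self, normSq_normSevenQuaternion]
    intro h
    have := congrArg QuaternionAlgebra.re h
    simp at this
  refine Equiv.ofBijective (fun y => ⟨⟨normSevenQuaternion s * y.1, ?_⟩, ?_⟩) ⟨?_, ?_⟩
  · rw [map_mul, normSq_normSevenQuaternion, y.2]; push_cast; rfl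
  · rw [← mul_assoc, h7]; exact dvd_mul_right _ _
  · intro y y' h
    have h : normSevenQuaternion s * y.1 = normSevenQuaternion s * y'.1 :=
      congrArg (fun z => z.1.1) h
    have h := congrArg (star (normSevenQuaternion s) * ·) h
    simp only [← mul_assoc, h7] at h
    exact Subtype.ext (mul_left_cancel₀ h70 h)
  · rintro ⟨⟨x, hx⟩, y, hy⟩
    have hy : star (normSevenQuaternion s) * x = 7 * y := hy
    have hc : (7 : ℍ[ℤ]) * normSevenQuaternion s = normSevenQuaternion s * 7 := by
      rw [← h7', mul_assoc, h7, h7']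
    -- The preimage of `x` is `star s * x / 7`; 7 is central and can be cancelled.
    have hxy : normSevenQuaternion s * y = x := by
      refine mul_left_cancel₀ h70 ?_
      rw [← mul_assoc, hc, mul_assoc, ← hy, ← mul_assoc, h7']
    refine ⟨⟨y, ?_⟩, by simp [hxy]⟩
    rw [← hxy, map_mul, normSq_normSevenQuaternion] at hx
    push_cast at hx
    linarith

/-- Count pairs `(s, x)` with `s` a left divisor of `x`: each of the 8 values of `s` contributes
`r_4(n)`, each `x` contributes 1 modulo 7, and `8 ≡ 1`. -/
theorem sumOfSquaresRepCount_four_mul_seven (n : ℕ) :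
    sumOfSquaresRepCount 4 (7 * n) ≡ sumOfSquaresRepCount 4 n [MOD 7] := by
  classical
  have hc : ∀ n, sumOfSquaresRepCount 4 n = Nat.card (QuaternionOfNorm n) := fun n =>
    (Nat.card_congr (quaternionOfNormEquiv n)).symm
  have := Fintype.ofFinite (QuaternionOfNorm (7 * n))
  rw [hc, hc]
  have h1 : ∑ s : Bool × Bool × Bool, (Finset.univ.filter fun x : QuaternionOfNorm (7 * n) =>
      7 ∣ star (normSevenQuaternion s) * x.1).card = 8 * Nat.card (QuaternionOfNorm n) := by
    rw [Finset.sum_congr rfl fun s _ => show _ = Nat.card (QuaternionOfNorm n) by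
      rw [Nat.card_congr (mulNormSevenEquiv n s), Nat.card_eq_fintype_card,
        Fintype.card_subtype]]
    simp
  have h2 := Finset.sum_card_bipartiteAbove_eq_sum_card_bipartiteBelow
    (s := (Finset.univ : Finset (Bool × Bool × Bool)))
    (t := (Finset.univ : Finset (QuaternionOfNorm (7 * n))))
    (fun s x => 7 ∣ star (normSevenQuaternion s) * x.1)
  simp only [Finset.bipartiteAbove, Finset.bipartiteBelow] at h2
  rw [h1] at h2
  have h3 : 8 * Nat.card (QuaternionOfNorm n) ≡ Nat.card (QuaternionOfNorm (7 * n)) [MOD 7] := by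
    rw [h2, ← ZMod.natCast_eq_natCast_iff, Nat.cast_sum, Nat.card_eq_fintype_card,
      Finset.sum_congr rfl fun x _ => show _ = (1 : ZMod 7) from ?_]
    · simp
    · rw [← Nat.cast_one, ZMod.natCast_eq_natCast_iff]
      exact card_filter_dvd_star_mul_mod_seven x.1 (by rw [x.2]; push_cast; exact dvd_mul_right _ _)
  have h4 : 8 * Nat.card (QuaternionOfNorm n) ≡ Nat.card (QuaternionOfNorm n) [MOD 7] := by
    unfold Nat.ModEq; omega
  exact h3.symm.trans h4

/-! ### The overpartition series is the inverse of the theta series -/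

open PowerSeries

/-- Generating function of the overpartitions. -/
noncomputable def overpartitionSeries : ℤ⟦X⟧ :=
  PowerSeries.mk fun n => (Nat.card (Overpartition n) : ℤ)

/-- The theta series `∑ (-1)^x q^(x^2)`. -/
noncomputable def altThetaSeries : ℤ⟦X⟧ :=
  PowerSeries.mk fun n => (-1) ^ n * (Nat.card {x : ℤ // x ^ 2 = (n : ℤ)} : ℤ)

/-- Overpartitions as partitions together with a set of part sizes. -/
def Overpartition.equivSigma (n : ℕ) :
    Overpartition n ≃ Σ p : n.Partition, p.parts.toFinset.powerset where
  toFun w := ⟨w.toPartition, w.overlined, Finset.mem_powerset.2 w.overlined_subset⟩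
  invFun w := ⟨w.1, w.2.1, Finset.mem_powerset.1 w.2.2⟩
  left_inv _ := rfl
  right_inv _ := rfl

theorem overpartitionSeries_eq_genFun :
    overpartitionSeries = Nat.Partition.genFun fun _ _ => (2 : ℤ) := by
  ext n
  rw [overpartitionSeries, coeff_mk, Nat.Partition.coeff_genFun,
    Nat.card_congr (Overpartition.equivSigma n), Nat.card_sigma]
  push_cast
  refine Finset.sum_congr rfl fun p _ => ?_
  rw [Nat.card_eq_fintype_card, Fintype.card_coe, Finset.card_powerset]
  simp [Finsupp.prod]

theorem card_sq_eq (n : ℕ) :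
    Nat.card {x : ℤ // x ^ 2 = (n : ℤ)} =
      if n = 0 then 1 else if IsSquare n then 2 else 0 := by
  split_ifs with h0 h
  · subst h0
    have : Unique {x : ℤ // x ^ 2 = ((0 : ℕ) : ℤ)} :=
      ⟨⟨⟨0, by simp⟩⟩, fun x => Subtype.ext (by simpa using x.2)⟩
    simp
  · obtain ⟨r, rfl⟩ := h
    have hr : (r : ℤ) ≠ 0 := by rintro h; simp_all
    have : {x : ℤ | x ^ 2 = ((r * r : ℕ) : ℤ)} = {(r : ℤ), -(r : ℤ)} := by
      ext x
      simp only [Set.mem_ofPred_eq, Set.mem_insert_iff, Set.mem_singleton_iff]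
      push_cast
      rw [← sq, sq_eq_sq_iff_eq_or_eq_neg]
    change Nat.card {x : ℤ | x ^ 2 = ((r * r : ℕ) : ℤ)} = 2
    rw [this, Nat.card_coe_set_eq, Set.ncard_pair]
    intro h
    omega
  · have : IsEmpty {x : ℤ // x ^ 2 = (n : ℤ)} := ⟨fun x => h ⟨x.1.natAbs, by
      zify
      rw [← sq, sq_abs, x.2]⟩⟩
    simp

theorem coeff_altThetaSeries_eq_partial {d n : ℕ} (h : d ≤ n) :
    coeff d altThetaSeries =
      coeff d (1 + 2 * ∑ k ∈ Finset.range n, (-1) ^ (k + 1) * (X : ℤ⟦X⟧) ^ ((k + 1) ^ 2)) := by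
  have hC : ∀ k : ℕ, ((-1) ^ (k + 1) : ℤ⟦X⟧) = C ((-1 : ℤ) ^ (k + 1)) := by simp
  have h2 : (2 : ℤ⟦X⟧) = C (2 : ℤ) := by simp
  rw [altThetaSeries, coeff_mk, card_sq_eq, map_add, h2, coeff_C_mul, map_sum]
  simp only [hC, coeff_C_mul, coeff_X_pow, coeff_one]
  split_ifs with h0 h1
  · subst h0
    rw [Finset.sum_eq_zero]
    · simp
    · intro k _
      rw [if_neg (by positivity), mul_zero]
  · obtain ⟨r, rfl⟩ := h1
    obtain ⟨r, rfl⟩ := Nat.exists_eq_succ_of_ne_zero (show r ≠ 0 by rintro rfl; simp at h0)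
    rw [Finset.sum_eq_single r]
    · have : (r + 1) * (r + 1) = (r + 1) ^ 2 := by ring
      simp only [Nat.succ_eq_add_one, this, if_true]
      -- A number and its square have the same parity, so the signs agree.
      rcases Nat.even_or_odd (r + 1) with h | h
      · simp [h.neg_one_pow, (h.pow_of_ne_zero two_ne_zero).neg_one_pow]
      · simp [h.neg_one_pow, h.pow.neg_one_pow]
    · intro b _ hb
      rw [if_neg, mul_zero]
      intro h
      apply hb
      have : (r + 1) ^ 2 = (b + 1) ^ 2 := by rw [← h]; simp [sq]
      have := Nat.pow_left_injective (n := 2) (by norm_num) this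
      omega
    · intro hr
      exfalso
      simp only [Finset.mem_range, not_lt] at hr
      have : (r + 1) * (r + 1) ≥ r + 1 := Nat.le_mul_self _
      simp only [Nat.succ_eq_add_one] at h
      omega
  · rw [Finset.sum_eq_zero]
    · simp
    · intro k _
      rw [if_neg, mul_zero]
      rintro rfl
      exact h1 ⟨k + 1, sq _⟩

open scoped PowerSeries.WithPiTopology
open Filter Topology

/-- The Euler factor of `P` is `(1 + x) / (1 - x)` with `x = X ^ (m + 1)`. -/
theorem one_add_two_tsum_mul_one_sub (m : ℕ) :
    (1 + ∑' j, (2 : ℤ) • (X : ℤ⟦X⟧) ^ ((m + 1) * (j + 1))) * (1 - X ^ (m + 1)) =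
      1 + X ^ (m + 1) := by
  have hs : Summable fun j => (2 : ℤ) • (X : ℤ⟦X⟧) ^ ((m + 1) * (j + 1)) :=
    Nat.Partition.summable_genFun_term (fun _ _ => (2 : ℤ)) m
  have h : ∑' j, (2 : ℤ) • (X : ℤ⟦X⟧) ^ ((m + 1) * (j + 1)) = 2 * X ^ (m + 1) +
      X ^ (m + 1) * ∑' j, (2 : ℤ) • (X : ℤ⟦X⟧) ^ ((m + 1) * (j + 1)) := by
    refine hs.tsum_eq_zero_add.trans ?_
    rw [← hs.tsum_mul_left]
    congr 1
    · simp
    · refine tsum_congr fun j => ?_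
      simp only [zsmul_eq_mul]
      ring
  linear_combination h

/-- With `E = ∏ (1 - X^k)`, `P * E = ∏ (1 + X^k)`. The finite identity tends to `P * E * Θ = E`. -/
theorem overpartitionSeries_mul_altThetaSeries : overpartitionSeries * altThetaSeries = 1 := by
  have hP : HasProd _ overpartitionSeries :=
    overpartitionSeries_eq_genFun ▸ Nat.Partition.hasProd_genFun fun _ _ => (2 : ℤ)
  have hE : HasProd (fun m => (1 : ℤ⟦X⟧) - X ^ (m + 1)) (pentagonalSeries ℤ) :=
    WithPiTopology.hasProd_one_sub_X_pow ℤ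
  set E : ℤ⟦X⟧ := pentagonalSeries ℤ
  have hB := (hP.mul hE).congr_fun fun m => (one_add_two_tsum_mul_one_sub m).symm
  have hφ : Tendsto (fun n => 1 + 2 * ∑ k ∈ Finset.range n,
      (-1) ^ (k + 1) * (X : ℤ⟦X⟧) ^ ((k + 1) ^ 2)) atTop (𝓝 altThetaSeries) := by
    rw [WithPiTopology.tendsto_iff_coeff_tendsto]
    exact fun d => tendsto_atTop_of_eventually_const (i₀ := d) fun n hn =>
      (coeff_altThetaSeries_eq_partial hn).symm
  have hrem : Tendsto (fun n => ∑ t ∈ Finset.range n, 2 * (-1) ^ (t + 1) *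
      (∏ k ∈ Finset.Ico (t + 1) n, (1 - (X : ℤ⟦X⟧) ^ (k + 1))) *
      (∏ k ∈ Finset.range t, (1 + (X : ℤ⟦X⟧) ^ (k + 1))) * X ^ ((t + 1) * (n + 1)))
      atTop (𝓝 0) := by
    rw [WithPiTopology.tendsto_iff_coeff_tendsto]
    refine fun d => tendsto_atTop_of_eventually_const (i₀ := d) fun n hn => ?_
    rw [map_sum, map_zero]
    refine Finset.sum_eq_zero fun t _ => ?_
    -- Each remainder term is divisible by `X ^ (n + 1)`, and `d ≤ n`.
    rw [coeff_mul_X_pow', if_neg]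
    nlinarith
  have h1 := hB.tendsto_prod_nat.mul hφ
  have h2 := hE.tendsto_prod_nat.add hrem
  simp only [finite_gauss_identity] at h1
  have h3 := tendsto_nhds_unique h1 h2
  have hE0 : E ≠ 0 := by
    intro h
    have h0 := coeff_pentagonalSeries_pentagonal ℤ 0
    rw [show pentagonalSeries ℤ = 0 from h] at h0
    simp at h0
  refine mul_right_cancel₀ hE0 ?_
  linear_combination h3

/-! ### Powers of the two series count tuples -/

theorem PowerSeries.coeff_pow_eq_sum_piAntidiag {R : Type*} [CommRing R] (F : R⟦X⟧) (k n : ℕ) :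
    coeff n (F ^ k) =
      ∑ a ∈ Finset.piAntidiag (Finset.univ : Finset (Fin k)) n, ∏ i, coeff (a i) F := by
  have h : F ^ k = ∏ _i : Fin k, F := by simp
  rw [h, coeff_prod]
  refine Finset.sum_bij (fun l _ => l) ?_ ?_ ?_ ?_
  · intro l hl
    simp only [Finset.mem_finsuppAntidiag] at hl
    simpa [Finset.mem_piAntidiag] using hl.1
  · intro l _ l' _ h
    exact DFunLike.coe_injective h
  · intro a ha
    refine ⟨Finsupp.equivFunOnFinite.symm a, ?_, rfl⟩
    simpa [Finset.mem_piAntidiag, Finset.mem_finsuppAntidiag] using ha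
  · intros; rfl

/-- Counts tuples of objects by total size. -/
theorem card_sigma_pi_eq_sum_piAntidiag (k n : ℕ) (T : ℕ → Type*) [∀ m, Finite (T m)] :
    Nat.card (Σ a : {a // a ∈ Finset.piAntidiag (Finset.univ : Finset (Fin k)) n},
      ∀ i, T (a.1 i)) =
      ∑ a ∈ Finset.piAntidiag (Finset.univ : Finset (Fin k)) n, ∏ i, Nat.card (T (a i)) := by
  rw [Nat.card_sigma, ← Finset.sum_coe_sort _ fun a : Fin k → ℕ => ∏ i, Nat.card (T (a i))]
  exact Finset.sum_congr rfl fun a _ => Nat.card_pi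

/-- Overpartition tuples as families of overpartitions indexed by their sizes. -/
def OverpartitionTuple.equivSigma (k n : ℕ) : OverpartitionTuple k n ≃
    Σ a : {a // a ∈ Finset.piAntidiag (Finset.univ : Finset (Fin k)) n},
      ∀ i, Overpartition (a.1 i) where
  toFun w := ⟨⟨w.size, by simp [Finset.mem_piAntidiag, w.sum_size]⟩, w.component⟩
  invFun w := ⟨w.1.1, w.2, (Finset.mem_piAntidiag.1 w.1.2).1⟩
  left_inv _ := rfl
  right_inv _ := rfl

theorem coeff_overpartitionSeries_pow (k n : ℕ) :
    coeff n (overpartitionSeries ^ k) = (overpartitionTupleCount k n : ℤ) := by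
  rw [coeff_pow_eq_sum_piAntidiag, overpartitionTupleCount,
    Nat.card_congr (OverpartitionTuple.equivSigma k n), card_sigma_pi_eq_sum_piAntidiag]
  simp [overpartitionSeries]

instance finite_int_sq_eq (n : ℕ) : Finite {x : ℤ // x ^ 2 = (n : ℤ)} :=
  Finite.of_injective (fun x => (⟨fun _ => x.1, by simpa using x.2⟩ :
    {x : Fin 1 → ℤ // ∑ i, x i ^ 2 = (n : ℤ)})) fun x y h =>
      Subtype.ext (congrFun (congrArg Subtype.val h) 0)

/-- Representations as a sum of squares, sorted by the squares. -/
def sumOfSquaresEquivSigma (k n : ℕ) : {x : Fin k → ℤ // ∑ i, x i ^ 2 = (n : ℤ)} ≃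
    Σ a : {a // a ∈ Finset.piAntidiag (Finset.univ : Finset (Fin k)) n},
      ∀ i, {x : ℤ // x ^ 2 = (a.1 i : ℤ)} where
  toFun x := ⟨⟨fun i => (x.1 i).natAbs ^ 2, by
    simp only [Finset.mem_piAntidiag, Finset.mem_univ, implies_true, and_true]
    zify
    simpa using x.2⟩, fun i => ⟨x.1 i, by simp⟩⟩
  invFun w := ⟨fun i => (w.2 i).1, by
    simp only [(w.2 _).2]
    exact_mod_cast (Finset.mem_piAntidiag.1 w.1.2).1⟩
  left_inv _ := rfl
  right_inv := by
    rintro ⟨⟨a, ha⟩, x⟩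
    have h : (fun i => (x i).1.natAbs ^ 2) = a := by
      funext i
      zify
      simpa using (x i).2
    -- Generalising the index to `b` lets `b = a` be substituted in the dependent second component.
    have key : ∀ (b : Fin k → ℕ) (hb : b ∈ Finset.piAntidiag Finset.univ n)
        (y : ∀ i, {z : ℤ // z ^ 2 = (b i : ℤ)}), b = a → (∀ i, (y i).1 = (x i).1) →
        (⟨⟨b, hb⟩, y⟩ : Σ a : {a // a ∈ Finset.piAntidiag (Finset.univ : Finset (Fin k)) n},
          ∀ i, {z : ℤ // z ^ 2 = (a.1 i : ℤ)}) = ⟨⟨a, ha⟩, x⟩ := by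
      rintro b hb y rfl hy
      rw [show y = x from funext fun i => Subtype.ext (hy i)]
    exact key _ _ _ h fun _ => rfl

theorem coeff_altThetaSeries_pow (k n : ℕ) :
    coeff n (altThetaSeries ^ k) = (-1) ^ n * (sumOfSquaresRepCount k n : ℤ) := by
  rw [coeff_pow_eq_sum_piAntidiag, sumOfSquaresRepCount,
    Nat.card_congr (sumOfSquaresEquivSigma k n),
    card_sigma_pi_eq_sum_piAntidiag k n fun m => {x : ℤ // x ^ 2 = (m : ℤ)}]
  push_cast
  rw [Finset.mul_sum]
  refine Finset.sum_congr rfl fun a ha => ?_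
  simp only [altThetaSeries, coeff_mk]
  rw [Finset.prod_mul_distrib, Finset.prod_pow_eq_pow_sum, (Finset.mem_piAntidiag.1 ha).1]

/-! ### Reduction modulo 7 and extraction of coefficients -/

theorem PowerSeries.expand_zmod (p : ℕ) [Fact p.Prime] (F : (ZMod p)⟦X⟧) :
    F.expand p (Fact.out : p.Prime).ne_zero = F ^ p := by
  have h := MvPowerSeries.map_frobenius_expand (R := ZMod p) p (Fact.out : p.Prime).ne_zero (f := F)
  rw [ZMod.frobenius_zmod] at h
  rw [MvPowerSeries.map_id] at h
  exact h

/-- Extraction of the coefficients of index divisible by `p` commutes with multiplication by a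
series in `X ^ p`. -/
theorem PowerSeries.mk_coeff_mul_expand {R : Type*} [CommRing R] (p : ℕ) (hp : p ≠ 0)
    (F G : R⟦X⟧) :
    (PowerSeries.mk fun n => coeff (p * n) (F * G.expand p hp)) =
      (PowerSeries.mk fun n => coeff (p * n) F) * G := by
  ext n
  rw [coeff_mk, coeff_mul, coeff_mul]
  refine (Finset.sum_of_injOn (fun a => (p * a.1, p * a.2)) ?_ ?_ ?_ ?_).symm
  · intro a _ b _ h
    simp only [Prod.mk.injEq, mul_right_inj' hp] at h
    exact Prod.ext h.1 h.2
  · intro a ha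
    simp only [Finset.mem_coe, Finset.HasAntidiagonal.mem_antidiagonal] at ha ⊢
    rw [← ha, mul_add]
  · rintro ⟨i, j⟩ hij hnot
    rw [coeff_expand_of_not_dvd, mul_zero]
    rintro ⟨j, rfl⟩
    have hij := Finset.HasAntidiagonal.mem_antidiagonal.1 hij
    obtain ⟨i, rfl⟩ : p ∣ i := (Nat.dvd_add_left (dvd_mul_right p j)).1 (hij ▸ dvd_mul_right p n)
    refine hnot ⟨(i, j), ?_, rfl⟩
    rw [← mul_add] at hij
    simpa using mul_left_cancel₀ hp hij
  · intro a _
    simp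

theorem mainTheorem7 (n : ℕ) (hn : 1 ≤ n) :
    (overpartitionTupleCount 3 (7 * n) : ℤ) ≡
      (-1) ^ n * (sumOfSquaresRepCount 3 n : ℤ) [ZMOD 7] := by
  have : Fact (Nat.Prime 7) := ⟨by norm_num⟩
  set f := PowerSeries.map (Int.castRingHom (ZMod 7))
  set P := f overpartitionSeries with hP
  set Θ := f altThetaSeries with hΘ
  have hPΘ : P * Θ = 1 := by
    rw [hP, hΘ, ← map_mul, overpartitionSeries_mul_altThetaSeries, map_one]
  have hcΘ : ∀ k n, coeff n (Θ ^ k) = (-1) ^ n * (sumOfSquaresRepCount k n : ZMod 7) := by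
    intro k n
    rw [hΘ, ← map_pow, coeff_map, coeff_altThetaSeries_pow]
    simp
  have h1 : P ^ 3 * Θ.expand 7 (Fact.out : Nat.Prime 7).ne_zero = Θ ^ 4 := by
    rw [PowerSeries.expand_zmod]
    calc P ^ 3 * Θ ^ 7 = (P * Θ) ^ 3 * Θ ^ 4 := by ring
      _ = Θ ^ 4 := by rw [hPΘ, one_pow, one_mul]
  have h2 := mk_coeff_mul_expand 7 (Fact.out : Nat.Prime 7).ne_zero (P ^ 3) Θ
  have h3 : (PowerSeries.mk fun n => coeff (7 * n) (Θ ^ 4)) = Θ ^ 4 := by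
    ext n
    rw [coeff_mk, hcΘ, hcΘ, pow_mul, (ZMod.natCast_eq_natCast_iff _ _ 7).2
      (sumOfSquaresRepCount_four_mul_seven n)]
    norm_num
  rw [h1, h3] at h2
  have h4 : (PowerSeries.mk fun n => coeff (7 * n) (P ^ 3)) = Θ ^ 3 := by
    -- Multiplying by `P` cancels `Θ`, since `P * Θ = 1`.
    linear_combination (-P) * h2 + (Θ ^ 3 - PowerSeries.mk fun n => coeff (7 * n) (P ^ 3)) * hPΘ
  have h5 := congrArg (coeff n) h4
  rw [coeff_mk, hcΘ, hP, ← map_pow, coeff_map, coeff_overpartitionSeries_pow] at h5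
  refine (ZMod.intCast_eq_intCast_iff _ _ 7).1 ?_
  push_cast
  simpa using h5
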